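/- Let $n\ge 2$ and let $G\subset\mathbb{R}^n$ be a bounded $1$-John domain: $G$ is a bounded domain (nonempty, open, connected), and there are a point $x_0\in G$ and a constant $c_J>0$ such that every $x\in G$ can be joined to $x_0$ by a rectifiable curve $\gamma:[0,l]\to G$, parametrized by arc length, with $\gamma(0)=x$, $\gamma(l)=x_0$, $l\le c_J$ and $\operatorname{dist}(\gamma(t),\partial G)\ge t/c_J$ for all $t\in[0,l]$. Let $1\le p<\infty$ and $\tau,\delta\in(0,1)$. Then $G$ supports the fractional $(p,p)$-Poincaré inequality: there is a finite constant $c$ such that for every $u\in L^p(G)$ \[ \int_G |u(x)-u_G|^p\,dx\le c\int_G\int_{G\cap B^n(x,\tau\operatorname{dist}(x,\partial G))}\frac{|u(x)-u(y)|^p}{|x-y|^{n+\delta p}}\,dy\,dx , \] where $u_G=\frac1{|G|}\int_G u\,dx$, $B^n(x,r)$ is the open ball with centre $x$ and radius $r$, and the right-hand side is allowed to be $+\infty$. -/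

import Mathlib

open MeasureTheory Set
open scoped NNReal ENNReal

/-- `G` is an `s`-John domain in `ℝⁿ`: a bounded domain (nonempty, open, connected) with a centre
`x₀ ∈ G` and a constant `c > 0` such that every `x ∈ G` is joined to `x₀` by a rectifiable curve
`γ : [0, l] → G` parametrized by arc length (for all `0 ≤ a ≤ b ≤ l`, the length of `γ` on
`[a, b]` is `b - a`), with `γ 0 = x`, `γ l = x₀`, `l ≤ c` and
`dist (γ t, ∂G) ≥ t ^ s / c` for all `t ∈ [0, l]`. -/
structure IsJohnDomain {n : ℕ} (s : ℝ) (G : Set (EuclideanSpace ℝ (Fin n))) : Prop where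
  isOpen : IsOpen G
  isConnected : IsConnected G
  isBounded : Bornology.IsBounded G
  exists_center : ∃ x₀ ∈ G, ∃ c : ℝ, 0 < c ∧ ∀ x ∈ G,
    ∃ (l : ℝ) (γ : ℝ → EuclideanSpace ℝ (Fin n)), 0 ≤ l ∧ l ≤ c ∧
      ContinuousOn γ (Icc 0 l) ∧ HasUnitSpeedOn γ (Icc 0 l) ∧ MapsTo γ (Icc 0 l) G ∧
      γ 0 = x ∧ γ l = x₀ ∧
      ∀ t ∈ Icc (0 : ℝ) l, t ^ s / c ≤ Metric.infDist (γ t) (frontier G)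

/-- The `[0, ∞]`-valued double integral
`∫_G ∫_{G ∩ B(x, τ dist(x, ∂G))} |u(x) - u(y)|^p / |x - y|^(n + δ p) dy dx`. -/
noncomputable def fractionalEnergy {n : ℕ} (G : Set (EuclideanSpace ℝ (Fin n))) (p δ τ : ℝ)
    (u : EuclideanSpace ℝ (Fin n) → ℝ) : ℝ≥0∞ :=
  ∫⁻ x in G, ∫⁻ y in G ∩ Metric.ball x (τ * Metric.infDist x (frontier G)),
    ‖u x - u y‖ₑ ^ p / ‖x - y‖ₑ ^ ((n : ℝ) + δ * p)

/-- `G` supports the fractional `(q, p)`-Poincaré inequality with parameters `δ` and `τ`: there is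
a finite constant `c` such that for all `u ∈ L^p(G)`, with `u_G` the mean value of `u` over `G`,
`∫_G |u - u_G|^q ≤ c (fractionalEnergy G p δ τ u)^(q / p)`. -/
def SupportsFractionalPoincare {n : ℕ} (G : Set (EuclideanSpace ℝ (Fin n)))
    (q p δ τ : ℝ) : Prop :=
  ∃ c : ℝ≥0, ∀ u : EuclideanSpace ℝ (Fin n) → ℝ,
    MemLp u (ENNReal.ofReal p) (volume.restrict G) →
      ∫⁻ x in G, ‖u x - ⨍ z in G, u z‖ₑ ^ q ≤ c * fractionalEnergy G p δ τ u ^ (q / p)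

open Filter Topology

/-! The proof is a chaining argument. A John curve from `x` to the centre carries balls `B_i`
centred at `σ (t i)` with radii `η * t i`, where `t i = l ^ i * T` decreases geometrically. `B_0` is
the same ball for every `x`, and the averages of `u` over `B_i` tend to `u x` at almost every `x` by
Lebesgue differentiation. So `|u x - a|`, with `a` the average over `B_0`, is at most the sum of the
jumps between consecutive averages.

By Jensen, the `p`-th power of the `i`-th jump is at most a constant `K i` times the integral of the
energy density over `G ∩ B(x, 2 t_i)` (`enorm_setAverage_closedBall_sub_rpow_le`). That set no
longer depends on the curve, so no measurable choice of curves is needed. Integrating in `x` by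
Tonelli bounds the `L^p` norm of the `i`-th term by a constant times `t_i ^ δ * E ^ (1 / p)`, with
`E` the energy. Since `δ > 0` these sum geometrically, and Minkowski's inequality concludes.
Replacing `a` by the mean of `u` costs a factor `2 ^ p`. -/

/-! ### Geometry of John domains -/

theorem closedBall_subset_of_lt_infDist_frontier {E : Type*} [NormedAddCommGroup E]
    [NormedSpace ℝ E] {G : Set E} {w : E} {r : ℝ} (hw : w ∈ G)
    (hr : r < Metric.infDist w (frontier G)) : Metric.closedBall w r ⊆ G := by
  by_contra h
  obtain ⟨z, hz, hzG⟩ := not_subset.1 h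
  have hr0 : 0 ≤ r := dist_nonneg.trans hz
  obtain ⟨y, hy, hyG⟩ := isPreconnected_closed_iff.1 (convex_closedBall w r).isPreconnected
    (closure G) (closure Gᶜ) isClosed_closure isClosed_closure
    (fun x _ => (em (x ∈ G)).imp (fun h => subset_closure h) fun h => subset_closure h)
    ⟨w, Metric.mem_closedBall_self hr0, subset_closure hw⟩ ⟨z, hz, subset_closure hzG⟩
  rw [← frontier_eq_closure_inter_closure] at hyG
  have := Metric.infDist_le_dist_of_mem (x := w) hyG
  rw [Metric.mem_closedBall, dist_comm] at hy
  linarith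

theorem HasUnitSpeedOn.dist_le {E : Type*} [PseudoMetricSpace E] {f : ℝ → E} {s : Set ℝ}
    (hf : HasUnitSpeedOn f s) {a b : ℝ} (ha : a ∈ s) (hb : b ∈ s) (hab : a ≤ b) :
    dist (f a) (f b) ≤ b - a := by
  have h := (hasConstantSpeedOnWith_iff_ordered.1 hf) ha hb hab
  have h2 := eVariationOn.edist_le f (s := s ∩ Icc a b) ⟨ha, le_refl _, hab⟩ ⟨hb, hab, le_refl _⟩
  rw [h, edist_dist, NNReal.coe_one, one_mul] at h2
  exact (ENNReal.ofReal_le_ofReal_iff (sub_nonneg.2 hab)).1 h2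

/-- Letting each John curve rest at `x₀` after its arrival gives all curves one parameter interval,
hence one common starting ball. -/
theorem IsJohnDomain.exists_cone_curves {n : ℕ} (hn : 1 ≤ n) {G : Set (EuclideanSpace ℝ (Fin n))}
    (hG : IsJohnDomain 1 G) :
    ∃ x₀ : EuclideanSpace ℝ (Fin n), ∃ T b : ℝ, 0 < T ∧ 0 < b ∧ b ≤ 1 ∧
      ∀ x ∈ G, ∃ σ : ℝ → EuclideanSpace ℝ (Fin n), σ 0 = x ∧ σ T = x₀ ∧
        (∀ t ∈ Icc 0 T, σ t ∈ G ∧ b * t ≤ Metric.infDist (σ t) (frontier G)) ∧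
        ∀ s ∈ Icc 0 T, ∀ t ∈ Icc 0 T, s ≤ t → dist (σ s) (σ t) ≤ t - s := by
  obtain ⟨x₀, hx₀, c, hc, h⟩ := hG.exists_center
  -- The endpoint of a John curve of positive length gives this. Openness alone would not exclude an
  -- empty frontier, where `infDist` is 0.
  have hD : 0 < Metric.infDist x₀ (frontier G) := by
    have : NeZero n := ⟨by omega⟩
    have : Nontrivial (EuclideanSpace ℝ (Fin n)) := inferInstance
    have : (𝓝[≠] x₀).NeBot := inferInstance
    obtain ⟨y, hyG, hy⟩ : ∃ y ∈ G, y ≠ x₀ := by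
      have h1 : ∀ᶠ y in 𝓝[≠] x₀, y ∈ G := nhdsWithin_le_nhds (hG.isOpen.mem_nhds hx₀)
      have h2 : ∀ᶠ y in 𝓝[≠] x₀, y ≠ x₀ := eventually_mem_nhdsWithin
      exact (h1.and h2).exists
    obtain ⟨l, γ, hl, -, -, -, -, h0, h1, h2⟩ := h y hyG
    have hl0 : 0 < l := by
      refine lt_of_le_of_ne hl ?_
      rintro rfl
      exact hy (h0.symm.trans h1)
    have := h2 l ⟨hl, le_rfl⟩
    rw [h1, Real.rpow_one] at this
    exact (div_pos hl0 hc).trans_le this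
  set D := Metric.infDist x₀ (frontier G)
  -- `c⁻¹` serves the moving part of the curve, `D / c` the resting part.
  refine ⟨x₀, c, min 1 (min c⁻¹ (D / c)), hc, by positivity, min_le_left _ _, fun x hx => ?_⟩
  obtain ⟨l, γ, hl, hlc, -, hs, hm, h0, h1, h2⟩ := h x hx
  have hb1 : min 1 (min c⁻¹ (D / c)) ≤ c⁻¹ := (min_le_right _ _).trans (min_le_left _ _)
  have hb2 : min 1 (min c⁻¹ (D / c)) ≤ D / c := (min_le_right _ _).trans (min_le_right _ _)
  have hmem : ∀ t ∈ Icc 0 c, min t l ∈ Icc 0 l := fun t ht => ⟨le_min ht.1 hl, min_le_right _ _⟩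
  refine ⟨fun t => γ (min t l), by simp [hl, h0], by simp [hlc, h1],
    fun t ht => ⟨hm (hmem t ht), ?_⟩, fun s hs' t ht hst => ?_⟩
  · rcases le_total t l with htl | htl
    · have := h2 t ⟨ht.1, htl⟩
      rw [Real.rpow_one] at this
      simp only [min_eq_left htl]
      refine le_trans ?_ this
      rw [div_eq_mul_inv t, mul_comm t]
      exact mul_le_mul_of_nonneg_right hb1 ht.1
    · simp only [min_eq_right htl, h1]
      calc _ ≤ D / c * t := mul_le_mul_of_nonneg_right hb2 ht.1
        _ ≤ D / c * c := mul_le_mul_of_nonneg_left ht.2 (by positivity)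
        _ = D := by field_simp
  · refine (hs.dist_le (hmem s hs') (hmem t ht) (min_le_min_right _ hst)).trans ?_
    rcases le_total t l with h | h
    · rw [min_eq_left h, min_eq_left (hst.trans h)]
    · rw [min_eq_right h]
      rcases le_total s l with h' | h'
      · rw [min_eq_left h']; linarith
      · rw [min_eq_right h']; linarith

/-! ### Jensen's inequality for averages, and Minkowski's inequality -/

theorem enorm_integral_sub_rpow_le {α : Type*} [MeasurableSpace α] {μ : Measure α}
    [IsProbabilityMeasure μ] {f : α → ℝ} (hf : Integrable f μ) (a : ℝ) {p : ℝ} (hp : 1 ≤ p) :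
    ‖∫ x, f x ∂μ - a‖ₑ ^ p ≤ ∫⁻ x, ‖f x - a‖ₑ ^ p ∂μ := by
  have h1 : ∫ x, f x ∂μ - a = ∫ x, (f x - a) ∂μ := by
    rw [integral_sub hf (integrable_const a)]; simp
  have hm : AEStronglyMeasurable (fun x => f x - a) μ :=
    hf.aestronglyMeasurable.sub aestronglyMeasurable_const
  have h2 : ‖∫ x, f x ∂μ - a‖ₑ ≤ eLpNorm' (fun x => f x - a) p μ := by
    rw [h1]
    refine (enorm_integral_le_lintegral_enorm _).trans ?_
    have := eLpNorm'_le_eLpNorm'_of_exponent_le (μ := μ) zero_lt_one hp hm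
    simpa [eLpNorm'] using this
  calc _ ≤ (eLpNorm' (fun x => f x - a) p μ) ^ p := by gcongr
    _ = _ := by
      rw [eLpNorm', one_div, ENNReal.rpow_inv_rpow (by linarith)]

theorem enorm_setAverage_sub_rpow_le {α : Type*} [MeasurableSpace α] {μ : Measure α}
    {s : Set α} (hs : μ s ≠ 0) (hs' : μ s ≠ ∞) {f : α → ℝ} (hf : IntegrableOn f s μ) (a : ℝ)
    {p : ℝ} (hp : 1 ≤ p) :
    ‖(⨍ x in s, f x ∂μ) - a‖ₑ ^ p ≤ (μ s)⁻¹ * ∫⁻ x in s, ‖f x - a‖ₑ ^ p ∂μ := by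
  have : IsProbabilityMeasure (((μ.restrict s) univ)⁻¹ • μ.restrict s) := by
    refine ⟨?_⟩
    simp [ENNReal.inv_mul_cancel hs hs']
  have := enorm_integral_sub_rpow_le (μ := ((μ.restrict s) univ)⁻¹ • μ.restrict s) (f := f)
    (hf.smul_measure (by simpa using hs)) a hp
  rw [average]
  refine this.trans_eq ?_
  rw [lintegral_smul_measure]
  simp

theorem enorm_setAverage_sub_setAverage_rpow_le {α : Type*} [MeasurableSpace α] {μ : Measure α}
    {s t : Set α} (hs : μ s ≠ 0) (hs' : μ s ≠ ∞) (ht : μ t ≠ 0) (ht' : μ t ≠ ∞) {f : α → ℝ}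
    (hf : IntegrableOn f s μ) (hft : IntegrableOn f t μ) {p : ℝ} (hp : 1 ≤ p) :
    ‖(⨍ x in s, f x ∂μ) - ⨍ x in t, f x ∂μ‖ₑ ^ p ≤
      (μ s)⁻¹ * ((μ t)⁻¹ * ∫⁻ x in s, ∫⁻ y in t, ‖f x - f y‖ₑ ^ p ∂μ ∂μ) := by
  refine (enorm_setAverage_sub_rpow_le hs hs' hf _ hp).trans ?_
  rw [← lintegral_const_mul' _ _ (ENNReal.inv_ne_top.2 ht)]
  gcongr with x
  rw [← enorm_neg, neg_sub]
  refine (enorm_setAverage_sub_rpow_le ht ht' hft _ hp).trans_eq ?_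
  congr 2 with y
  rw [← enorm_neg, neg_sub]

/-- Minkowski's inequality for countable sums. -/
theorem lintegral_tsum_rpow_le {α : Type*} [MeasurableSpace α] {μ : Measure α} {p : ℝ}
    (hp : 1 ≤ p) {F : ℕ → α → ℝ≥0∞} (hF : ∀ i, Measurable (F i)) {a : ℕ → ℝ≥0∞} {E : ℝ≥0∞}
    (h : ∀ i, ∫⁻ x, F i x ^ p ∂μ ≤ a i ^ p * E) :
    ∫⁻ x, (∑' i, F i x) ^ p ∂μ ≤ (∑' i, a i) ^ p * E := by
  have hp0 : 0 < p := by linarith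
  have hfin : ∀ N : ℕ, (∫⁻ x, (∑ i ∈ Finset.range N, F i x) ^ p ∂μ) ^ (1 / p) ≤
      (∑ i ∈ Finset.range N, a i) * E ^ (1 / p) := by
    intro N
    induction N with
    | zero => simp [hp0]
    | succ N ih =>
      simp only [Finset.sum_range_succ, add_mul]
      have hN := ENNReal.lintegral_Lp_add_le (μ := μ)
        (Finset.measurable_fun_sum (Finset.range N) fun i _ => hF i).aemeasurable
        (hF N).aemeasurable hp
      simp only [Pi.add_apply] at hN
      refine hN.trans (add_le_add ih ?_)
      calc _ ≤ (a N ^ p * E) ^ (1 / p) := by gcongr; exact h N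
        _ = _ := by
          rw [ENNReal.mul_rpow_of_nonneg _ _ (by positivity), one_div,
            ENNReal.rpow_rpow_inv hp0.ne']
  have hfin' : ∀ N : ℕ, ∫⁻ x, (∑ i ∈ Finset.range N, F i x) ^ p ∂μ ≤ (∑' i, a i) ^ p * E := by
    intro N
    have := ENNReal.rpow_le_rpow (hfin N) hp0.le
    rw [one_div, ENNReal.rpow_inv_rpow hp0.ne', ENNReal.mul_rpow_of_nonneg _ _ hp0.le,
      ENNReal.rpow_inv_rpow hp0.ne'] at this
    refine this.trans ?_
    gcongr
    exact ENNReal.sum_le_tsum _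
  -- Monotone convergence carries the finite bounds to the series.
  have hsup : ∀ x, (∑' i, F i x) ^ p = ⨆ N : ℕ, (∑ i ∈ Finset.range N, F i x) ^ p := by
    intro x
    rw [ENNReal.tsum_eq_iSup_nat]
    exact (ENNReal.orderIsoRpow p hp0).map_iSup _
  simp only [hsup]
  rw [lintegral_iSup fun N =>
    (Finset.measurable_fun_sum (Finset.range N) fun i _ => hF i).pow_const p]
  · exact iSup_le hfin'
  · intro N M hNM x
    dsimp only
    gcongr

/-! ### The energy density and its integrals over balls -/

/-- The inner integral of `fractionalEnergy`. -/
noncomputable def fractionalEnergyDensity {n : ℕ} (G : Set (EuclideanSpace ℝ (Fin n)))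
    (p δ τ : ℝ) (u : EuclideanSpace ℝ (Fin n) → ℝ) (x : EuclideanSpace ℝ (Fin n)) : ℝ≥0∞ :=
  ∫⁻ y in G ∩ Metric.ball x (τ * Metric.infDist x (frontier G)),
    ‖u x - u y‖ₑ ^ p / ‖x - y‖ₑ ^ ((n : ℝ) + δ * p)

theorem fractionalEnergy_eq_lintegral_density {n : ℕ} (G : Set (EuclideanSpace ℝ (Fin n)))
    (p δ τ : ℝ) (u : EuclideanSpace ℝ (Fin n) → ℝ) :
    fractionalEnergy G p δ τ u = ∫⁻ x in G, fractionalEnergyDensity G p δ τ u x := rfl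

theorem measurable_fractionalEnergyDensity {n : ℕ} (G : Set (EuclideanSpace ℝ (Fin n)))
    (p δ τ : ℝ) {u : EuclideanSpace ℝ (Fin n) → ℝ} (hu : Measurable u) :
    Measurable (fractionalEnergyDensity G p δ τ u) := by
  set S : Set (EuclideanSpace ℝ (Fin n) × EuclideanSpace ℝ (Fin n)) :=
    {z | dist z.2 z.1 < τ * Metric.infDist z.1 (frontier G)} with hS
  have hSm : MeasurableSet S := by
    refine (isOpen_lt (by fun_prop) ?_).measurableSet
    exact continuous_const.mul ((Metric.continuous_infDist_pt _).comp continuous_fst)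
  have hm : Measurable (S.indicator fun z : EuclideanSpace ℝ (Fin n) × EuclideanSpace ℝ (Fin n) =>
      ‖u z.1 - u z.2‖ₑ ^ p / ‖z.1 - z.2‖ₑ ^ ((n : ℝ) + δ * p)) := by
    refine Measurable.indicator ?_ hSm
    fun_prop
  have := hm.lintegral_prod_right' (ν := volume.restrict G)
  convert this using 2 with x
  rw [fractionalEnergyDensity, inter_comm, ← Measure.restrict_restrict measurableSet_ball,
    ← lintegral_indicator measurableSet_ball]
  rfl

theorem fractionalEnergyDensity_congr_ae {n : ℕ} {G : Set (EuclideanSpace ℝ (Fin n))}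
    (p δ τ : ℝ) {u v : EuclideanSpace ℝ (Fin n) → ℝ}
    (huv : u =ᵐ[volume.restrict G] v) {x : EuclideanSpace ℝ (Fin n)} (hx : u x = v x) :
    fractionalEnergyDensity G p δ τ u x = fractionalEnergyDensity G p δ τ v x := by
  refine lintegral_congr_ae ?_
  filter_upwards [ae_mono (Measure.restrict_mono_set volume inter_subset_left) huv] with y hy
  rw [hx, hy]

theorem fractionalEnergy_congr_ae {n : ℕ} {G : Set (EuclideanSpace ℝ (Fin n))}
    (p δ τ : ℝ) {u v : EuclideanSpace ℝ (Fin n) → ℝ}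
    (huv : u =ᵐ[volume.restrict G] v) :
    fractionalEnergy G p δ τ u = fractionalEnergy G p δ τ v := by
  refine lintegral_congr_ae ?_
  filter_upwards [huv] with x hx
  exact fractionalEnergyDensity_congr_ae p δ τ huv hx

/-- On `s` the singular kernel is at least `t ^ (-(n + δ p))`; on the diagonal the numerator
vanishes. -/
theorem setLIntegral_enorm_sub_rpow_le_density {n : ℕ} {G : Set (EuclideanSpace ℝ (Fin n))}
    {p δ τ : ℝ} (hp : 0 < p) (hδ : 0 ≤ δ) (u : EuclideanSpace ℝ (Fin n) → ℝ)
    {s : Set (EuclideanSpace ℝ (Fin n))} (hs : MeasurableSet s) {x : EuclideanSpace ℝ (Fin n)}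
    (hsG : s ⊆ G ∩ Metric.ball x (τ * Metric.infDist x (frontier G))) {t : ℝ}
    (hst : ∀ y ∈ s, dist x y ≤ t) :
    ∫⁻ y in s, ‖u x - u y‖ₑ ^ p ≤
      ENNReal.ofReal t ^ ((n : ℝ) + δ * p) * fractionalEnergyDensity G p δ τ u x := by
  have hexp : 0 ≤ (n : ℝ) + δ * p := by positivity
  rw [fractionalEnergyDensity, ← lintegral_const_mul' _ _
    (ENNReal.rpow_ne_top_of_nonneg hexp ENNReal.ofReal_ne_top)]
  refine le_trans ?_ (lintegral_mono_set hsG)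
  refine setLIntegral_mono' hs fun y hy => ?_
  rcases eq_or_ne x y with rfl | hxy
  · simp [hp]
  have hd : ‖x - y‖ₑ ≤ ENNReal.ofReal t := by
    rw [← edist_eq_enorm_sub, edist_dist]
    exact ENNReal.ofReal_le_ofReal (hst y hy)
  have h0 : ‖x - y‖ₑ ^ ((n : ℝ) + δ * p) ≠ 0 := by
    have : ‖x - y‖ₑ ≠ 0 := by simpa [sub_eq_zero] using hxy
    exact (ENNReal.rpow_pos (pos_iff_ne_zero.2 this) enorm_ne_top).ne'
  calc _ = ‖x - y‖ₑ ^ ((n : ℝ) + δ * p) *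
        (‖u x - u y‖ₑ ^ p / ‖x - y‖ₑ ^ ((n : ℝ) + δ * p)) :=
        (ENNReal.mul_div_cancel h0 (ENNReal.rpow_ne_top_of_nonneg hexp enorm_ne_top)).symm
    _ ≤ _ := by gcongr

theorem measurable_setLIntegral_inter_closedBall {n : ℕ} (G : Set (EuclideanSpace ℝ (Fin n)))
    (r : ℝ) {g : EuclideanSpace ℝ (Fin n) → ℝ≥0∞} (hg : Measurable g) :
    Measurable fun x => ∫⁻ y in G ∩ Metric.closedBall x r, g y := by
  have hS : MeasurableSet {z : EuclideanSpace ℝ (Fin n) × EuclideanSpace ℝ (Fin n) |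
      dist z.2 z.1 ≤ r} := (isClosed_le (by fun_prop) (by fun_prop)).measurableSet
  have := ((hg.comp measurable_snd).indicator hS).lintegral_prod_right'
    (ν := volume.restrict G)
  convert this using 2 with x
  rw [inter_comm, ← Measure.restrict_restrict measurableSet_closedBall,
    ← lintegral_indicator measurableSet_closedBall]
  rfl

/-- Tonelli, with the symmetry of `dist x y ≤ r`. -/
theorem lintegral_setLIntegral_inter_closedBall_le {n : ℕ} (G : Set (EuclideanSpace ℝ (Fin n)))
    (r : ℝ) {g : EuclideanSpace ℝ (Fin n) → ℝ≥0∞} (hg : Measurable g) :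
    ∫⁻ x in G, ∫⁻ y in G ∩ Metric.closedBall x r, g y ≤
      volume (Metric.closedBall (0 : EuclideanSpace ℝ (Fin n)) r) * ∫⁻ y in G, g y := by
  have hS : MeasurableSet {z : EuclideanSpace ℝ (Fin n) × EuclideanSpace ℝ (Fin n) |
      dist z.2 z.1 ≤ r} := (isClosed_le (by fun_prop) (by fun_prop)).measurableSet
  have hm := (hg.comp measurable_snd).indicator hS
  calc _ = ∫⁻ x in G, ∫⁻ y in G, (Metric.closedBall x r).indicator g y := by
        congr 1 with x
        rw [inter_comm, ← Measure.restrict_restrict measurableSet_closedBall,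
          ← lintegral_indicator measurableSet_closedBall]
    _ = ∫⁻ y in G, ∫⁻ x in G, (Metric.closedBall x r).indicator g y :=
        lintegral_lintegral_swap (f := fun x y => (Metric.closedBall x r).indicator g y)
          hm.aemeasurable
    _ = ∫⁻ y in G, ∫⁻ x in G, (Metric.closedBall y r).indicator (fun _ => g y) x := by
        congr 1 with y
        congr 1 with x
        simp only [indicator, Metric.mem_closedBall, dist_comm]
    _ ≤ ∫⁻ y in G, ∫⁻ x, (Metric.closedBall y r).indicator (fun _ => g y) x := by
        gcongr
        exact Measure.restrict_le_self
    _ = ∫⁻ y in G, volume (Metric.closedBall (0 : EuclideanSpace ℝ (Fin n)) r) * g y := by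
        congr 1 with y
        rw [lintegral_indicator measurableSet_closedBall, setLIntegral_const, mul_comm,
          Measure.addHaar_closedBall_center]
    _ = _ := lintegral_const_mul _ hg

/-! ### The chain of balls -/

/-- The powers of `t` are `-n`, `-n`, `n + δ p` and `n`, so only the summable gain `t ^ (δ p)`
survives. -/
theorem ball_volume_constant {n : ℕ} {p δ η l t : ℝ} (hη : 0 < η) (hl : 0 < l) (ht : 0 < t) :
    (volume (Metric.closedBall (0 : EuclideanSpace ℝ (Fin n)) (η * t)))⁻¹ *
      ((volume (Metric.closedBall (0 : EuclideanSpace ℝ (Fin n)) (η * (l * t))))⁻¹ *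
        ENNReal.ofReal t ^ ((n : ℝ) + δ * p)) *
      volume (Metric.closedBall (0 : EuclideanSpace ℝ (Fin n)) (2 * t)) =
    ENNReal.ofReal ((2 / (η * (η * l))) ^ n *
      (volume.real (Metric.ball (0 : EuclideanSpace ℝ (Fin n)) 1))⁻¹) *
      (ENNReal.ofReal t ^ δ) ^ p := by
  set ω := volume.real (Metric.ball (0 : EuclideanSpace ℝ (Fin n)) 1) with hω
  have hω0 : 0 < ω := by
    rw [hω, measureReal_def]
    exact ENNReal.toReal_pos (Metric.measure_ball_pos volume _ one_pos).ne' measure_ball_lt_top.ne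
  have hV : ∀ r : ℝ, 0 < r → volume (Metric.closedBall (0 : EuclideanSpace ℝ (Fin n)) r) =
      ENNReal.ofReal (r ^ n * ω) := by
    intro r hr
    rw [Measure.addHaar_closedBall _ _ hr.le, finrank_euclideanSpace_fin,
      ENNReal.ofReal_mul (by positivity), hω, ofReal_measureReal measure_ball_lt_top.ne]
  rw [hV _ (by positivity), hV _ (by positivity), hV _ (by positivity),
    ← ENNReal.ofReal_inv_of_pos (by positivity), ← ENNReal.ofReal_inv_of_pos (by positivity),
    ENNReal.ofReal_rpow_of_pos ht, ENNReal.ofReal_rpow_of_pos ht,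
    ENNReal.ofReal_rpow_of_pos (by positivity), ← ENNReal.ofReal_mul (by positivity),
    ← ENNReal.ofReal_mul (by positivity), ← ENNReal.ofReal_mul (by positivity),
    ← ENNReal.ofReal_mul (by positivity)]
  congr 1
  rw [Real.rpow_add ht, Real.rpow_natCast, ← Real.rpow_mul ht.le]
  simp only [mul_pow, div_pow]
  field_simp

/-- Points `y`, `z` of the two balls satisfy `dist y z < 3 η t`, while `y` has distance at least `(b
- η) t` from the frontier. Since `4 η ≤ τ b` and `τ < 1`, `3 η ≤ τ (b - η)`: the second ball lies in
the region of integration of the density at `y`. -/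
theorem enorm_setAverage_closedBall_sub_rpow_le {n : ℕ} {G : Set (EuclideanSpace ℝ (Fin n))}
    {p δ τ b η l t : ℝ} (hp : 1 ≤ p) (hδ : 0 ≤ δ) (hτ : τ < 1) (hb : 0 < b) (hb1 : b ≤ 1)
    (hη : 0 < η) (hητ : 4 * η ≤ τ * b) (hl : 0 < l) (hl1 : l < 1) (hlη : 1 - l ≤ η) (ht : 0 < t)
    {u : EuclideanSpace ℝ (Fin n) → ℝ} (hu : IntegrableOn u G)
    {x w w' : EuclideanSpace ℝ (Fin n)} (hw : w ∈ G) (hw' : w' ∈ G)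
    (hwd : b * t ≤ Metric.infDist w (frontier G))
    (hwd' : b * (l * t) ≤ Metric.infDist w' (frontier G))
    (hxw : dist x w ≤ t) (hww' : dist w w' ≤ (1 - l) * t) :
    ‖(⨍ y in Metric.closedBall w (η * t), u y) -
        ⨍ y in Metric.closedBall w' (η * (l * t)), u y‖ₑ ^ p ≤
      (volume (Metric.closedBall (0 : EuclideanSpace ℝ (Fin n)) (η * t)))⁻¹ *
        ((volume (Metric.closedBall (0 : EuclideanSpace ℝ (Fin n)) (η * (l * t))))⁻¹ *
          ENNReal.ofReal t ^ ((n : ℝ) + δ * p)) *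
        ∫⁻ y in G ∩ Metric.closedBall x (2 * t), fractionalEnergyDensity G p δ τ u y := by
  have hτ0 : 0 < τ := by
    by_contra h
    nlinarith
  have hηb : 4 * η < b := by nlinarith
  have hlt : l * t < t := by nlinarith
  have hlt0 : 0 < l * t := by positivity
  have hBG : Metric.closedBall w (η * t) ⊆ G :=
    closedBall_subset_of_lt_infDist_frontier hw (lt_of_lt_of_le (by nlinarith) hwd)
  have hBG' : Metric.closedBall w' (η * (l * t)) ⊆ G :=
    closedBall_subset_of_lt_infDist_frontier hw' (lt_of_lt_of_le (by nlinarith) hwd')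
  have hfin : ∀ (z : EuclideanSpace ℝ (Fin n)) (r : ℝ), volume (Metric.closedBall z r) ≠ ∞ :=
    fun z r => measure_closedBall_lt_top.ne
  have hpos : ∀ (z : EuclideanSpace ℝ (Fin n)) (r : ℝ), 0 < r →
      volume (Metric.closedBall z r) ≠ 0 :=
    fun z r hr => (Metric.measure_closedBall_pos volume z hr).ne'
  refine (enorm_setAverage_sub_setAverage_rpow_le (hpos w _ (by positivity)) (hfin _ _)
    (hpos w' _ (by positivity)) (hfin _ _) (hu.mono_set hBG) (hu.mono_set hBG') hp).trans ?_
  rw [Measure.addHaar_closedBall_center volume w, Measure.addHaar_closedBall_center volume w',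
    mul_assoc, mul_assoc]
  gcongr
  rw [← lintegral_const_mul' _ _
    (ENNReal.rpow_ne_top_of_nonneg (by positivity) ENNReal.ofReal_ne_top)]
  refine (setLIntegral_mono' measurableSet_closedBall fun y hy => ?_).trans
    (lintegral_mono_set (subset_inter hBG ?_))
  · rw [Metric.mem_closedBall] at hy
    have hyd : (b - η) * t ≤ Metric.infDist y (frontier G) := by
      have := Metric.infDist_le_infDist_add_dist (s := frontier G) (x := w) (y := y)
      rw [dist_comm] at this
      linarith
    have hyz : ∀ z ∈ Metric.closedBall w' (η * (l * t)), dist y z < 3 * η * t := by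
      intro z hz
      rw [Metric.mem_closedBall, dist_comm] at hz
      have h1 := dist_triangle4 y w w' z
      have h2 : (1 - l) * t ≤ η * t := by gcongr
      have h3 : η * (l * t) < η * t := by gcongr
      linarith
    refine setLIntegral_enorm_sub_rpow_le_density (by linarith) hδ u measurableSet_closedBall
      (fun z hz => ⟨hBG' hz, ?_⟩) fun z hz => (hyz z hz).le.trans ?_
    · rw [Metric.mem_ball, dist_comm]
      calc _ < 3 * η * t := hyz z hz
        _ ≤ τ * ((b - η) * t) := by
          rw [← mul_assoc]
          exact mul_le_mul_of_nonneg_right (by nlinarith) ht.le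
        _ ≤ _ := by gcongr
    · nlinarith
  · intro y hy
    rw [Metric.mem_closedBall] at hy ⊢
    have := dist_triangle y w x
    rw [dist_comm w x] at this
    nlinarith

theorem lintegral_enorm_sub_setAverage_rpow_le {n : ℕ} {G : Set (EuclideanSpace ℝ (Fin n))}
    (hG : MeasurableSet G) {x₀ : EuclideanSpace ℝ (Fin n)} {T b : ℝ} (hT : 0 < T) (hb : 0 < b)
    (hb1 : b ≤ 1)
    (hσ : ∀ x ∈ G, ∃ σ : ℝ → EuclideanSpace ℝ (Fin n), σ 0 = x ∧ σ T = x₀ ∧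
      (∀ t ∈ Icc 0 T, σ t ∈ G ∧ b * t ≤ Metric.infDist (σ t) (frontier G)) ∧
      ∀ s ∈ Icc 0 T, ∀ t ∈ Icc 0 T, s ≤ t → dist (σ s) (σ t) ≤ t - s)
    {p δ τ : ℝ} (hp : 1 ≤ p) (hδ : 0 < δ) (hτ : 0 < τ) (hτ1 : τ < 1) :
    ∃ c : ℝ≥0∞, c ≠ ∞ ∧ ∀ u : EuclideanSpace ℝ (Fin n) → ℝ, Measurable u → IntegrableOn u G →
      ∃ a : ℝ, ∫⁻ x in G, ‖u x - a‖ₑ ^ p ≤ c * fractionalEnergy G p δ τ u := by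
  have hp0 : 0 < p := by linarith
  set η := τ * b / 4 with hη
  have hη0 : 0 < η := by positivity
  have hη1 : η < 1 := by
    have : τ * b ≤ 1 * 1 := mul_le_mul hτ1.le hb1 hb.le zero_le_one
    linarith
  set l := 1 - η with hl
  have hl0 : 0 < l := by linarith
  have hl1 : l < 1 := by linarith
  set t : ℕ → ℝ := fun i => l ^ i * T with ht
  have ht0 : ∀ i, 0 < t i := fun i => by positivity
  have htT : ∀ i, t i ∈ Icc 0 T := fun i =>
    ⟨(ht0 i).le, mul_le_of_le_one_left hT.le (pow_le_one₀ hl0.le hl1.le)⟩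
  have hts : ∀ i, t (i + 1) = l * t i := fun i => by simp only [ht, pow_succ]; ring
  set C := ENNReal.ofReal ((2 / (η * (η * l))) ^ n *
      (volume.real (Metric.ball (0 : EuclideanSpace ℝ (Fin n)) 1))⁻¹) with hC
  set K : ℕ → ℝ≥0∞ := fun i =>
    (volume (Metric.closedBall (0 : EuclideanSpace ℝ (Fin n)) (η * t i)))⁻¹ *
      ((volume (Metric.closedBall (0 : EuclideanSpace ℝ (Fin n)) (η * (l * t i))))⁻¹ *
        ENNReal.ofReal (t i) ^ ((n : ℝ) + δ * p)) with hK
  set a : ℕ → ℝ≥0∞ := fun i => C ^ p⁻¹ * ENNReal.ofReal (t i) ^ δ with ha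
  have hsum : ∑' i, a i ≠ ∞ := by
    have h1 : ∀ i, a i = C ^ p⁻¹ * ENNReal.ofReal T ^ δ * (ENNReal.ofReal l ^ δ) ^ i := by
      intro i
      simp only [ha, ht]
      rw [ENNReal.ofReal_mul (by positivity), ENNReal.mul_rpow_of_nonneg _ _ hδ.le,
        ENNReal.ofReal_pow hl0.le, ← ENNReal.rpow_natCast, ← ENNReal.rpow_natCast,
        ← ENNReal.rpow_mul, ← ENNReal.rpow_mul, mul_comm (i : ℝ)]
      ring
    have h2 : ENNReal.ofReal l ^ δ < 1 :=
      ENNReal.rpow_lt_one (by simpa using hl1) hδ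
    simp only [h1]
    rw [ENNReal.tsum_mul_left, ENNReal.tsum_geometric]
    refine ENNReal.mul_ne_top (ENNReal.mul_ne_top ?_ ?_) ?_
    · exact ENNReal.rpow_ne_top_of_nonneg (by positivity) ENNReal.ofReal_ne_top
    · exact ENNReal.rpow_ne_top_of_nonneg hδ.le ENNReal.ofReal_ne_top
    · exact ENNReal.inv_ne_top.2 (tsub_pos_of_lt h2).ne'
  refine ⟨(∑' i, a i) ^ p, ENNReal.rpow_ne_top_of_nonneg hp0.le hsum, fun u hum hui => ?_⟩
  set g := fractionalEnergyDensity G p δ τ u with hg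
  have hgm : Measurable g := measurable_fractionalEnergyDensity G p δ τ hum
  set F : ℕ → EuclideanSpace ℝ (Fin n) → ℝ≥0∞ := fun i x =>
    (K i * ∫⁻ y in G ∩ Metric.closedBall x (2 * t i), g y) ^ p⁻¹ with hF
  have hFm : ∀ i, Measurable (F i) := fun i =>
    ((measurable_setLIntegral_inter_closedBall G _ hgm).const_mul _).pow_const _
  have hFi : ∀ i, ∫⁻ x in G, F i x ^ p ≤ a i ^ p * fractionalEnergy G p δ τ u := by
    intro i
    simp only [hF, ENNReal.rpow_inv_rpow hp0.ne']
    rw [lintegral_const_mul _ (measurable_setLIntegral_inter_closedBall G _ hgm)]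
    calc _ ≤ K i * (volume (Metric.closedBall (0 : EuclideanSpace ℝ (Fin n)) (2 * t i)) *
          ∫⁻ y in G, g y) := by
          gcongr
          exact lintegral_setLIntegral_inter_closedBall_le G _ hgm
      _ = _ := by
        rw [← mul_assoc, hK, ball_volume_constant hη0 hl0 (ht0 i), ha,
          ENNReal.mul_rpow_of_nonneg _ _ hp0.le, ENNReal.rpow_inv_rpow hp0.ne',
          fractionalEnergy_eq_lintegral_density]
  refine ⟨⨍ y in Metric.closedBall x₀ (η * T), u y, ?_⟩
  refine le_trans (lintegral_mono_ae ?_) (lintegral_tsum_rpow_le hp hFm hFi)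
  -- The balls need not contain `x`: since `dist x (σ (t i)) ≤ t i`, their dilates by `η⁻¹` do, and
  -- this is enough for differentiation. Here `u` is extended by zero outside `G`.
  have hLeb := IsUnifLocDoublingMeasure.ae_tendsto_average
    (volume : Measure (EuclideanSpace ℝ (Fin n)))
    (((integrable_indicator_iff hG).2 hui).locallyIntegrable) η⁻¹
  filter_upwards [ae_restrict_of_ae hLeb, ae_restrict_mem hG] with x hx hxG
  obtain ⟨σ, hσ0, hσT, hσG, hσd⟩ := hσ x hxG
  have hxσ : ∀ i, dist x (σ (t i)) ≤ t i := fun i => by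
    have := hσd 0 ⟨le_rfl, hT.le⟩ (t i) (htT i) (ht0 i).le
    rwa [hσ0, sub_zero] at this
  set A : ℕ → ℝ := fun i => ⨍ y in Metric.closedBall (σ (t i)) (η * t i), u y with hA
  have hlim : Tendsto A atTop (𝓝 (u x)) := by
    have htl : Tendsto (fun i => η * t i) atTop (𝓝[>] 0) := by
      refine tendsto_nhdsWithin_iff.2 ⟨?_, .of_forall fun i => mul_pos hη0 (ht0 i)⟩
      have := ((tendsto_pow_atTop_nhds_zero_of_lt_one hl0.le hl1).mul_const T).const_mul η
      simpa using this
    have h := hx (fun i => σ (t i)) (fun i => η * t i) htl (.of_forall fun i => by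
      rw [Metric.mem_closedBall, inv_mul_cancel_left₀ hη0.ne']
      exact hxσ i)
    rw [indicator_of_mem hxG] at h
    refine h.congr fun i => setAverage_congr_fun measurableSet_closedBall (.of_forall ?_)
    intro y hy
    refine indicator_of_mem (closedBall_subset_of_lt_infDist_frontier (hσG _ (htT i)).1
      (lt_of_lt_of_le ?_ (hσG _ (htT i)).2) hy) _
    have : η < b := by nlinarith
    exact mul_lt_mul_of_pos_right this (ht0 i)
  have hstep : ∀ i, edist (A i) (A i.succ) ≤ F i x := by
    intro i
    rw [edist_eq_enorm_sub, hF, ENNReal.le_rpow_inv_iff hp0]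
    have h1 := hσG _ (htT i)
    have h2 := hσG _ (htT (i + 1))
    have h3 := hσd _ (htT (i + 1)) _ (htT i) (by rw [hts]; nlinarith [ht0 i])
    simp only [hA, Nat.succ_eq_add_one]
    rw [hts] at h2 h3 ⊢
    exact enorm_setAverage_closedBall_sub_rpow_le hp hδ.le hτ1 hb hb1 hη0 (by rw [hη]; linarith)
      hl0 hl1 (by rw [hl]; linarith) (ht0 i) hui h1.1 h2.1 h1.2 h2.2 (hxσ i)
      (by rw [dist_comm]; linarith)
  have hA0 : A 0 = ⨍ y in Metric.closedBall x₀ (η * T), u y := by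
    simp [hA, ht, hσT]
  -- Telescoping from the fixed ball `B_0` to the limit `u x`.
  have := edist_le_tsum_of_edist_le_of_tendsto₀ (fun i => F i x) hstep hlim
  rw [← hA0, ← edist_eq_enorm_sub, edist_comm]
  gcongr

/-! ### From an arbitrary constant to the mean value -/

/-- Convexity gives `2 ^ (p - 1)` for splitting at `a`; by Jensen the mean is no farther from `a`
than `f` is in `L^p`, which gives the other factor 2. -/
theorem lintegral_enorm_sub_setAverage_self_rpow_le {α : Type*} [MeasurableSpace α]
    {μ : Measure α} {s : Set α} (hs : μ s ≠ 0) (hs' : μ s ≠ ∞) {f : α → ℝ}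
    (hf : IntegrableOn f s μ) (a : ℝ) {p : ℝ} (hp : 1 ≤ p) :
    ∫⁻ x in s, ‖f x - ⨍ z in s, f z ∂μ‖ₑ ^ p ∂μ ≤ 2 ^ p * ∫⁻ x in s, ‖f x - a‖ₑ ^ p ∂μ := by
  set m := ⨍ z in s, f z ∂μ with hm
  have hconst : ∫⁻ x in s, ‖m - a‖ₑ ^ p ∂μ ≤ ∫⁻ x in s, ‖f x - a‖ₑ ^ p ∂μ := by
    rw [setLIntegral_const]
    calc _ ≤ ((μ s)⁻¹ * ∫⁻ x in s, ‖f x - a‖ₑ ^ p ∂μ) * μ s := by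
          gcongr
          exact enorm_setAverage_sub_rpow_le hs hs' hf a hp
      _ = _ := by
        rw [mul_comm, ← mul_assoc, ENNReal.mul_inv_cancel hs hs', one_mul]
  have hpt : ∀ x, ‖f x - m‖ₑ ^ p ≤
      2 ^ (p - 1) * (‖f x - a‖ₑ ^ p + ‖m - a‖ₑ ^ p) := by
    intro x
    refine le_trans ?_ (ENNReal.rpow_add_le_mul_rpow_add_rpow _ _ hp)
    gcongr
    rw [← sub_sub_sub_cancel_right (f x) m a]
    exact enorm_sub_le
  calc _ ≤ ∫⁻ x in s, 2 ^ (p - 1) * (‖f x - a‖ₑ ^ p + ‖m - a‖ₑ ^ p) ∂μ :=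
        lintegral_mono hpt
    _ = 2 ^ (p - 1) * (∫⁻ x in s, ‖f x - a‖ₑ ^ p ∂μ + ∫⁻ x in s, ‖m - a‖ₑ ^ p ∂μ) := by
        rw [lintegral_const_mul' _ _ (ENNReal.rpow_ne_top_of_nonneg (by linarith) (by simp)),
          lintegral_add_right _ measurable_const]
    _ ≤ 2 ^ (p - 1) * (∫⁻ x in s, ‖f x - a‖ₑ ^ p ∂μ + ∫⁻ x in s, ‖f x - a‖ₑ ^ p ∂μ) := by
        gcongr
    _ = _ := by
        rw [← two_mul, ← mul_assoc]
        congr 1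
        rw [ENNReal.rpow_sub _ _ two_ne_zero ENNReal.ofNat_ne_top, ENNReal.rpow_one,
          ENNReal.div_mul_cancel two_ne_zero ENNReal.ofNat_ne_top]

theorem theorem4p2 (n : ℕ) (hn : 2 ≤ n) (G : Set (EuclideanSpace ℝ (Fin n)))
    (hG : IsJohnDomain 1 G) (p δ τ : ℝ) (hp : 1 ≤ p)
    (hδ : 0 < δ ∧ δ < 1) (hτ : 0 < τ ∧ τ < 1) :
    SupportsFractionalPoincare G p p δ τ := by
  obtain ⟨x₀, T, b, hT, hb, hb1, hσ⟩ := hG.exists_cone_curves (by omega)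
  obtain ⟨c, hc, h⟩ := lintegral_enorm_sub_setAverage_rpow_le hG.isOpen.measurableSet hT hb hb1 hσ
    hp hδ.1 hτ.1 hτ.2
  have hG0 : volume G ≠ 0 := (hG.isOpen.measure_pos volume hG.isConnected.nonempty).ne'
  have hG1 : volume G ≠ ∞ := hG.isBounded.measure_lt_top.ne
  have : IsFiniteMeasure (volume.restrict G) := isFiniteMeasure_restrict.2 hG1
  have hc' : 2 ^ p * c ≠ ∞ :=
    ENNReal.mul_ne_top (ENNReal.rpow_ne_top_of_nonneg (by linarith) (by simp)) hc
  refine ⟨(2 ^ p * c).toNNReal, fun u hu => ?_⟩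
  have hui : IntegrableOn u G := hu.integrable (by simpa using hp)
  -- The Tonelli arguments need a measurable representative; the energy depends only on the almost
  -- everywhere class on `G`.
  obtain ⟨v, hvm, huv⟩ := hu.aestronglyMeasurable
  have hvi : IntegrableOn v G := Integrable.congr hui huv
  obtain ⟨a, ha⟩ := h v hvm.measurable hvi
  rw [ENNReal.coe_toNNReal hc', div_self (by linarith), ENNReal.rpow_one,
    fractionalEnergy_congr_ae p δ τ huv]
  calc _ ≤ 2 ^ p * ∫⁻ x in G, ‖u x - a‖ₑ ^ p :=
        lintegral_enorm_sub_setAverage_self_rpow_le hG0 hG1 hui a hp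
    _ = 2 ^ p * ∫⁻ x in G, ‖v x - a‖ₑ ^ p := by
        congr 1
        refine lintegral_congr_ae ?_
        filter_upwards [huv] with x hx
        rw [hx]
    _ ≤ _ := by
        rw [mul_assoc]
        gcongr
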